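/- A Hurwitz dessin $\mathcal D$ consists of a finite set $\Omega$ and permutations $x,y,z$ of $\Omega$, of orders $3,2,7$, acting on the right, with $xyz=1$ and such that its monodromy group $G=\langle x,y\rangle$ is transitive on $\Omega$. It is planar if the numbers of cycles (fixed points included) of $x,y,z$ add up to $|\Omega|+2$, that is, if it has genus $0$. For $k\in\{1,2,3\}$, a $(k)$-handle is an ordered pair $(a,b)$ of distinct fixed points of $y$ with $b=az^{1-k}x$. Given a $(k)$-handle $(a,b)$ of $\mathcal D$, the self-join $\mathcal D^*=\mathcal D(k)\mathcal D$ is formed from two disjoint copies of $\mathcal D$ by replacing the four fixed points $a_1,b_1,a_2,b_2$ of $y$ by the $2$-cycles $(a_1,a_2)$ and $(b_1,b_2)$, all other cycles of $x$ and $y$ being unchanged. A double covering $\mathcal E\to\mathcal D$ is a surjection of the underlying sets that commutes with the actions of $x$ and of $y$ and all of whose fibres have two elements. **Lemma 4.4.** Let $\mathcal D$ be a planar Hurwitz dessin in which $y$ has exactly two fixed points $a,b$, and suppose that $(a,b)$ is a $(k)$-handle for some $k\in\{1,2,3\}$. Then $\mathcal D^*=\mathcal D(k)\mathcal D$ is a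 Hurwitz dessin, the natural projection $\mathcal D^*\to\mathcal D$ is a double covering, and for every double covering $\mathcal E\to\mathcal D$ by a Hurwitz dessin $\mathcal E$ there is an isomorphism $\mathcal D^*\to\mathcal E$ (a bijection commuting with $x$ and $y$) compatible with the projections to $\mathcal D$. If, in addition, the stabiliser $H=G_\omega$ of some $\omega\in\Omega$ in the monodromy group $G$ of $\mathcal D$ has a subgroup $H^*$ of index $2$, then there is an isomorphism from the monodromy group $G^*$ of $\mathcal D^*$ to $G$ that takes the generators $x,y$ of $G^*$ to the generators $x,y$ of $G$, and takes the stabiliser in $G^*$ of each of the two points of $\mathcal D^*$ above $\omega$ to $H^*$. -/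

import Mathlib

universe u v

/-- The permutations representing the standard generators `X` and `Y` on the set `Ω` of edges of
an oriented hypermap; the third permutation `z` is determined by them. -/
structure Hypermap (Ω : Type u) where
  x : Equiv.Perm Ω
  y : Equiv.Perm Ω

namespace Hypermap

variable {Ω : Type u} {Ω' : Type v}

/-- Permutations are written on the right in `xyz = 1`: first `x`, then `y`, then `z` is the
identity. In Mathlib, where `(f * g) ω = f (g ω)`, this reads `z * y * x = 1`. -/
def z (D : Hypermap Ω) : Equiv.Perm Ω := (D.y * D.x)⁻¹

/-- The monodromy group `G = ⟨x, y⟩`. -/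
def monodromy (D : Hypermap Ω) : Subgroup (Equiv.Perm Ω) := Subgroup.closure {D.x, D.y}

/-- The generator `x` as an element of the monodromy group. -/
def genX (D : Hypermap Ω) : D.monodromy := ⟨D.x, Subgroup.subset_closure (by simp)⟩

/-- The generator `y` as an element of the monodromy group. -/
def genY (D : Hypermap Ω) : D.monodromy := ⟨D.y, Subgroup.subset_closure (by simp)⟩

/-- A Hurwitz dessin: a finite connected oriented hypermap of type `(3, 2, 7)`. -/
structure IsHurwitz (D : Hypermap Ω) : Prop where
  finite : Finite Ω
  order_x : orderOf D.x = 3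
  order_y : orderOf D.y = 2
  order_z : orderOf D.z = 7
  transitive : MulAction.IsPretransitive D.monodromy Ω

/-- The number of cycles of a permutation, fixed points included. -/
noncomputable def numCycles (f : Equiv.Perm Ω) : ℕ :=
  Nat.card (Quotient (Equiv.Perm.SameCycle.setoid f))

/-- The Euler characteristic of the underlying surface: black vertices, white vertices and faces
are the cycles of `x`, `y` and `z`, and the edges are the elements of `Ω`. -/
noncomputable def eulerChar (D : Hypermap Ω) : ℤ :=
  (numCycles D.x : ℤ) + (numCycles D.y : ℤ) + (numCycles D.z : ℤ) - (Nat.card Ω : ℤ)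

/-- Planar, that is, of genus `g = 0` where `χ = 2 - 2g` (used for connected finite hypermaps). -/
def IsPlanar (D : Hypermap Ω) : Prop := D.eulerChar = 2

/-- `(a, b)` is a `(k)`-handle, `k ∈ {1, 2, 3}`: two distinct fixed points of `y` with
`b = a z ^ (1 - k) x` (right action: first `z ^ (1 - k)`, then `x`). -/
structure IsHandle (D : Hypermap Ω) (k : ℕ) (a b : Ω) : Prop where
  one_le : 1 ≤ k
  le_three : k ≤ 3
  ne : a ≠ b
  fixed_a : D.y a = a
  fixed_b : D.y b = b
  eq : b = D.x ((D.z ^ (1 - (k : ℤ))) a)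

open Classical in
/-- The `(k)`-join of two hypermaps along `(k)`-handles `(a₁, b₁)` and `(a₂, b₂)`: the cycles of `x`
and `y` are those on the two parts, except that the fixed points `a₁, b₁, a₂, b₂` of `y` are
replaced by the 2-cycles `(a₁, a₂)` and `(b₁, b₂)`. -/
noncomputable def join {D₁ : Hypermap Ω} {D₂ : Hypermap Ω'} {k : ℕ} {a₁ b₁ : Ω} {a₂ b₂ : Ω'}
    (_h₁ : D₁.IsHandle k a₁ b₁) (_h₂ : D₂.IsHandle k a₂ b₂) : Hypermap (Ω ⊕ Ω') where
  x := Equiv.sumCongr D₁.x D₂.x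
  y := Equiv.swap (Sum.inl a₁) (Sum.inr a₂) * Equiv.swap (Sum.inl b₁) (Sum.inr b₂) *
    Equiv.sumCongr D₁.y D₂.y

/-- `p` is a `d`-sheeted covering `E → D` of hypermaps. -/
structure IsCovering (E : Hypermap Ω') (D : Hypermap Ω) (d : ℕ) (p : Ω' → Ω) : Prop where
  map_x : ∀ ω, p (E.x ω) = D.x (p ω)
  map_y : ∀ ω, p (E.y ω) = D.y (p ω)
  surjective : Function.Surjective p
  card_fibre : ∀ ω, (p ⁻¹' {ω}).ncard = d

/-- `e` is an isomorphism of hypermaps. -/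
structure IsIso (D : Hypermap Ω) (E : Hypermap Ω') (e : Ω ≃ Ω') : Prop where
  map_x : ∀ ω, e (D.x ω) = E.x (e ω)
  map_y : ∀ ω, e (D.y ω) = E.y (e ω)

end Hypermap

/-! Label the two points of each fibre by `ZMod 2`. A double cover becomes a pair of voltages `(sx,
sy)` on the base, and relabelling the fibres adds a coboundary. The lifts of `x` and of `y * x` have
odd orders 3 and 7, so voltages sum to zero over black vertices and faces; since `y` lifts to an
involution, they also do so over its 2-cycles. Only `a` and `b` can carry a nonzero sum, and the
total forces `sy a = sy b`. Adding `sy a` times the voltages of the self-join kills every cycle sum,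
and on a sphere such a pair is a coboundary (`exists_coboundary_eq`). If `sy a = 0` the cover would
be disconnected; so `sy a = 1` and relabelling gives the self-join (`exists_iso_join`). The
self-join is itself Hurwitz because `a` and `b` lie on one face, where their voltages cancel. For
the last claim, the cosets of the index 2 subgroup form a Hurwitz double cover with monodromy group
`G`, which uniqueness identifies with the self-join. -/

namespace Hypermap

/-! ### Cohomology of a planar hypermap over `ZMod 2` -/

section Cocycles

variable {Ω : Type u}

/-- A function invariant under both generators of a transitive hypermap is constant. -/
theorem eq_of_invariant {β : Type*} {D : Hypermap Ω}
    (hD : MulAction.IsPretransitive D.monodromy Ω) {f : Ω → β}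
    (hx : ∀ ω, f (D.x ω) = f ω) (hy : ∀ ω, f (D.y ω) = f ω) (ω₁ ω₂ : Ω) : f ω₁ = f ω₂ := by
  obtain ⟨⟨g, hg⟩, rfl⟩ := hD.exists_smul_eq ω₁ ω₂
  have key : ∀ ω, f (g ω) = f ω := by
    induction hg using Subgroup.closure_induction with
    | mem g hg =>
      rcases hg with rfl | rfl
      · exact hx
      · exact hy
    | one => simp
    | mul g h _ _ hg hh => intro ω; rw [Equiv.Perm.mul_apply, hg, hh]
    | inv g _ hg => intro ω; rw [← hg]; exact congrArg f (g.apply_symm_apply ω)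
  exact (key ω₁).symm

/-- A hypermap is transitive if every set invariant under both generators is empty or full. -/
theorem isPretransitive_of_invariant {D : Hypermap Ω}
    (h : ∀ f : Ω → Prop, (∀ ω, f (D.x ω) = f ω) → (∀ ω, f (D.y ω) = f ω) →
      ∀ ω₁ ω₂, f ω₁ = f ω₂) : MulAction.IsPretransitive D.monodromy Ω := by
  refine ⟨fun ω₁ ω₂ => ?_⟩
  have inv : ∀ (g : D.monodromy) (ω : Ω),
      (g • ω ∈ MulAction.orbit D.monodromy ω₁) = (ω ∈ MulAction.orbit D.monodromy ω₁) :=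
    fun g ω => by
      rw [← MulAction.orbit_eq_iff, ← MulAction.orbit_eq_iff, MulAction.orbit_smul]
  have := h (fun ω => ω ∈ MulAction.orbit D.monodromy ω₁) (inv D.genX) (inv D.genY) ω₁ ω₂
  have h2 : ω₂ ∈ MulAction.orbit D.monodromy ω₁ := this ▸ MulAction.mem_orbit_self ω₁
  exact h2

/-- Reindexing by `g` makes the two halves of the sum equal. Invariant weights `α` stand in for
indicators of cycles, which avoids summing over individual cycles. -/
theorem sum_mul_coboundary_eq_zero [Fintype Ω] (g : Equiv.Perm Ω) {α : Ω → ZMod 2}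
    (hα : ∀ ω, α (g ω) = α ω) (f : Ω → ZMod 2) : ∑ ω, α ω * (f (g ω) + f ω) = 0 := by
  have h : ∑ ω, α ω * f (g ω) = ∑ ω, α ω * f ω := by
    rw [← Equiv.sum_comp g (fun ω => α ω * f ω)]
    simp only [hα]
  simp only [mul_add, Finset.sum_add_distrib, h]
  exact CharTwo.add_self_eq_zero _

/-- Functions on the cycles of `x`, `y` and `z`, pulled back to pairs of functions on `Ω`; this is
dual to summing a pair of voltages over the cycles. -/
def cyclePullback (D : Hypermap Ω) :
    ((Quotient (Equiv.Perm.SameCycle.setoid D.x) → ZMod 2) ×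
      (Quotient (Equiv.Perm.SameCycle.setoid D.y) → ZMod 2) ×
      (Quotient (Equiv.Perm.SameCycle.setoid D.z) → ZMod 2)) →ₗ[ZMod 2]
      (Ω → ZMod 2) × (Ω → ZMod 2) where
  -- A face step from `ω` uses the `x`-voltage at `ω` and then the `y`-voltage at `D.x ω`; hence the
  -- shift by `D.x.symm`.
  toFun t := (fun ω => t.1 ⟦ω⟧ + t.2.2 ⟦ω⟧, fun ω => t.2.1 ⟦ω⟧ + t.2.2 ⟦D.x.symm ω⟧)
  map_add' s t := by
    ext ω <;> simp <;> ring
  map_smul' c t := by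
    ext ω <;> simp <;> ring

/-- The coboundary of a function on `Ω`. -/
def coboundary (D : Hypermap Ω) : (Ω → ZMod 2) →ₗ[ZMod 2] (Ω → ZMod 2) × (Ω → ZMod 2) where
  toFun f := (fun ω => f (D.x ω) + f ω, fun ω => f (D.y ω) + f ω)
  map_add' s t := by
    ext ω <;> simp <;> ring
  map_smul' c t := by
    ext ω <;> simp <;> ring

/-- The standard bilinear form on pairs of functions. -/
def voltagePairing [Fintype Ω] : (Ω → ZMod 2) × (Ω → ZMod 2) →ₗ[ZMod 2]
    Module.Dual (ZMod 2) ((Ω → ZMod 2) × (Ω → ZMod 2)) :=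
  LinearMap.mk₂ (ZMod 2) (fun s t => ∑ ω, t.1 ω * s.1 ω + ∑ ω, t.2 ω * s.2 ω)
    (by intros; simp [mul_add, Finset.sum_add_distrib]; ring)
    (by intros; simp [Finset.mul_sum, mul_add, mul_left_comm])
    (by intros; simp [add_mul, Finset.sum_add_distrib]; ring)
    (by intros; simp [Finset.mul_sum, mul_add, mul_assoc])

theorem voltagePairing_apply [Fintype Ω] (s t : (Ω → ZMod 2) × (Ω → ZMod 2)) :
    voltagePairing s t = ∑ ω, t.1 ω * s.1 ω + ∑ ω, t.2 ω * s.2 ω := rfl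

theorem voltagePairing_injective [Fintype Ω] :
    Function.Injective (voltagePairing (Ω := Ω)) := by
  classical
  rw [injective_iff_map_eq_zero]
  intro s hs
  ext ω
  · simpa [voltagePairing_apply, Pi.single_apply] using
      LinearMap.congr_fun hs (Pi.single ω 1, 0)
  · simpa [voltagePairing_apply, Pi.single_apply] using
      LinearMap.congr_fun hs (0, Pi.single ω 1)

theorem mk_apply_eq (g : Equiv.Perm Ω) (ω : Ω) :
    (⟦g ω⟧ : Quotient (Equiv.Perm.SameCycle.setoid g)) = ⟦ω⟧ :=
  Quotient.sound (Equiv.Perm.sameCycle_apply_left.2 (Equiv.Perm.SameCycle.refl g ω))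

theorem z_y_x_apply (D : Hypermap Ω) (ω : Ω) : D.z (D.y (D.x ω)) = ω :=
  (D.y * D.x).symm_apply_apply ω

/-- A pair of voltages whose weighted cycle sums vanish annihilates the pulled back functions. -/
theorem mem_annihilator_of_sums [Fintype Ω] (D : Hypermap Ω) (s : (Ω → ZMod 2) × (Ω → ZMod 2))
    (hx : ∀ α : Ω → ZMod 2, (∀ ω, α (D.x ω) = α ω) → ∑ ω, α ω * s.1 ω = 0)
    (hy : ∀ α : Ω → ZMod 2, (∀ ω, α (D.y ω) = α ω) → ∑ ω, α ω * s.2 ω = 0)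
    (hz : ∀ α : Ω → ZMod 2, (∀ ω, α (D.y (D.x ω)) = α ω) →
      ∑ ω, α ω * (s.1 ω + s.2 (D.x ω)) = 0) :
    s ∈ (LinearMap.range D.cyclePullback).dualAnnihilator.comap voltagePairing := by
  rw [Submodule.mem_comap, Submodule.mem_dualAnnihilator]
  rintro _ ⟨⟨α, β, γ⟩, rfl⟩
  have h₁ := hx (fun ω => α ⟦ω⟧) (fun ω => by simp only [mk_apply_eq])
  have h₂ := hy (fun ω => β ⟦ω⟧) (fun ω => by simp only [mk_apply_eq])
  have h₃ := hz (fun ω => γ ⟦ω⟧) (fun ω => by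
    rw [← mk_apply_eq D.z (D.y (D.x ω)), z_y_x_apply])
  have h₄ : ∑ ω, γ ⟦D.x.symm ω⟧ * s.2 ω = ∑ ω, γ ⟦ω⟧ * s.2 (D.x ω) := by
    rw [← Equiv.sum_comp D.x]
    simp
  simp only [mul_add, Finset.sum_add_distrib] at h₃
  simp only [voltagePairing_apply, cyclePullback, LinearMap.coe_mk, AddHom.coe_mk, add_mul,
    Finset.sum_add_distrib, h₁, h₂, h₄]
  simpa using h₃

/-- In a kernel element the three functions agree on `Ω`, so they are invariant under `x` and `y`
and hence constant. -/
theorem finrank_ker_cyclePullback_le (D : Hypermap Ω) [Finite Ω] [Nonempty Ω]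
    (hD : MulAction.IsPretransitive D.monodromy Ω) :
    Module.finrank (ZMod 2) (LinearMap.ker D.cyclePullback) ≤ 1 := by
  obtain ⟨ω₀⟩ := ‹Nonempty Ω›
  let ev : LinearMap.ker D.cyclePullback →ₗ[ZMod 2] ZMod 2 :=
    { toFun := fun t => t.1.2.2 ⟦ω₀⟧
      map_add' := fun _ _ => rfl
      map_smul' := fun _ _ => rfl }
  have hev : Function.Injective ev := by
    rw [injective_iff_map_eq_zero]
    rintro ⟨⟨α, β, γ⟩, ht⟩ h0
    have hγ₀ : γ ⟦ω₀⟧ = 0 := h0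
    rw [LinearMap.mem_ker, Prod.ext_iff] at ht
    have hα : ∀ ω, α ⟦ω⟧ = γ ⟦ω⟧ := fun ω => by
      have h : α ⟦ω⟧ + γ ⟦ω⟧ = 0 := congrFun ht.1 ω
      exact CharTwo.add_eq_zero.1 h
    have hγx : ∀ ω, γ ⟦D.x ω⟧ = γ ⟦ω⟧ := fun ω => by
      rw [← hα, ← hα, mk_apply_eq]
    have hβ : ∀ ω, β ⟦ω⟧ = γ ⟦ω⟧ := fun ω => by
      have h : β ⟦ω⟧ + γ ⟦D.x.symm ω⟧ = 0 := congrFun ht.2 ω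
      rw [CharTwo.add_eq_zero.1 h, ← hγx (D.x.symm ω), Equiv.apply_symm_apply]
    have hγy : ∀ ω, γ ⟦D.y ω⟧ = γ ⟦ω⟧ := fun ω => by
      rw [← hβ, ← hβ, mk_apply_eq]
    have hγ : ∀ ω : Ω, γ ⟦ω⟧ = 0 := fun ω =>
      (eq_of_invariant hD (f := fun ω => γ ⟦ω⟧) hγx hγy ω ω₀).trans hγ₀
    ext c
    · induction c using Quotient.inductionOn with | h ω => exact (hα ω).trans (hγ ω)
    · induction c using Quotient.inductionOn with | h ω => exact (hβ ω).trans (hγ ω)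
    · induction c using Quotient.inductionOn with | h ω => exact hγ ω
  simpa using LinearMap.finrank_le_finrank_of_injective hev

theorem finrank_ker_coboundary_le (D : Hypermap Ω) [Finite Ω] [Nonempty Ω]
    (hD : MulAction.IsPretransitive D.monodromy Ω) :
    Module.finrank (ZMod 2) (LinearMap.ker D.coboundary) ≤ 1 := by
  obtain ⟨ω₀⟩ := ‹Nonempty Ω›
  let ev : LinearMap.ker D.coboundary →ₗ[ZMod 2] ZMod 2 :=
    { toFun := fun f => f.1 ω₀
      map_add' := fun _ _ => rfl
      map_smul' := fun _ _ => rfl }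
  have hev : Function.Injective ev := by
    rw [injective_iff_map_eq_zero]
    rintro ⟨f, hf⟩ h0
    rw [LinearMap.mem_ker, Prod.ext_iff] at hf
    ext ω
    exact (eq_of_invariant hD (f := f) (fun ω => CharTwo.add_eq_zero.1 (congrFun hf.1 ω))
      (fun ω => CharTwo.add_eq_zero.1 (congrFun hf.2 ω)) ω ω₀).trans h0
  simpa using LinearMap.finrank_le_finrank_of_injective hev

/-- The first cohomology of the sphere with coefficients in `ZMod 2` vanishes: on a planar
hypermap, a pair of voltages with vanishing cycle sums is a coboundary. -/
theorem exists_coboundary_eq (D : Hypermap Ω) [Fintype Ω] [Nonempty Ω]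
    (hD : MulAction.IsPretransitive D.monodromy Ω) (hplanar : D.IsPlanar)
    (s : (Ω → ZMod 2) × (Ω → ZMod 2))
    (hx : ∀ α : Ω → ZMod 2, (∀ ω, α (D.x ω) = α ω) → ∑ ω, α ω * s.1 ω = 0)
    (hy : ∀ α : Ω → ZMod 2, (∀ ω, α (D.y ω) = α ω) → ∑ ω, α ω * s.2 ω = 0)
    (hz : ∀ α : Ω → ZMod 2, (∀ ω, α (D.y (D.x ω)) = α ω) →
      ∑ ω, α ω * (s.1 ω + s.2 (D.x ω)) = 0) :
    ∃ f, D.coboundary f = s := by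
  classical
  have hle : LinearMap.range D.coboundary ≤
      (LinearMap.range D.cyclePullback).dualAnnihilator.comap voltagePairing := by
    rintro _ ⟨f, rfl⟩
    refine D.mem_annihilator_of_sums _ (fun α hα => sum_mul_coboundary_eq_zero D.x hα f)
      (fun α hα => sum_mul_coboundary_eq_zero D.y hα f) fun α hα => ?_
    -- Along a face step the `x`- and `y`-coboundaries telescope to that of `D.y * D.x`.
    rw [← sum_mul_coboundary_eq_zero (D.y * D.x) hα f]
    refine Finset.sum_congr rfl fun ω _ => ?_
    have h2 : f (D.x ω) + f (D.x ω) = 0 := CharTwo.add_self_eq_zero _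
    simp only [coboundary, LinearMap.coe_mk, AddHom.coe_mk, Equiv.Perm.mul_apply]
    linear_combination α ω * h2
  have h₁ := LinearMap.finrank_range_add_finrank_ker D.cyclePullback
  have h₂ := LinearMap.finrank_range_add_finrank_ker D.coboundary
  have h₃ := Subspace.finrank_add_finrank_dualAnnihilator_eq (LinearMap.range D.cyclePullback)
  have h₄ : Module.finrank (ZMod 2)
      ((LinearMap.range D.cyclePullback).dualAnnihilator.comap voltagePairing) ≤
      Module.finrank (ZMod 2) (LinearMap.range D.cyclePullback).dualAnnihilator := by
    refine LinearMap.finrank_le_finrank_of_injective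
      (f := (voltagePairing (Ω := Ω)).restrict (fun s hs => hs)) ?_
    intro s t hst
    exact Subtype.ext (voltagePairing_injective (congrArg Subtype.val hst))
  have h₅ := D.finrank_ker_cyclePullback_le hD
  have h₆ := D.finrank_ker_coboundary_le hD
  have h₇ : (numCycles D.x : ℤ) + numCycles D.y + numCycles D.z - Nat.card Ω = 2 := hplanar
  have := fun g : Equiv.Perm Ω => Fintype.ofFinite (Quotient (Equiv.Perm.SameCycle.setoid g))
  simp only [numCycles, Nat.card_eq_fintype_card] at h₇
  simp only [Module.finrank_prod, Module.finrank_fintype_fun_eq_card] at h₁ h₂ h₃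
  -- With `n` points there are `n + 2` cycles, so the pullback has rank at least `n + 1` and its
  -- annihilator dimension at most `2n - (n + 1) = n - 1`; coboundaries already have dimension at
  -- least `n - 1`.
  have heq := Submodule.eq_of_le_of_finrank_le hle (by omega)
  have hs := D.mem_annihilator_of_sums s hx hy hz
  rw [← heq] at hs
  exact hs

end Cocycles

/-! ### Voltages of two-sheeted covers -/

section Voltages

variable {Ω : Type u} {Ω' : Type v} {q : Ω' → Ω} {l : Ω' → ZMod 2}

theorem zmod_two_eq_add_one {i j : ZMod 2} (h : i ≠ j) : i = j + 1 := by
  revert i j; decide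

theorem zmod_two_eq_one {i : ZMod 2} (h : i ≠ 0) : i = 1 := by
  simpa using zmod_two_eq_add_one h

/-- The points of a two-sheeted cover can be labelled by the base point and a sheet. -/
theorem exists_labelling (hq : ∀ ω, (q ⁻¹' {ω}).ncard = 2) :
    ∃ l : Ω' → ZMod 2, Function.Bijective fun w => (q w, l w) := by
  classical
  choose s t hne hst using fun ω => Set.ncard_eq_two.1 (hq ω)
  have hs : ∀ ω, q (s ω) = ω := fun ω => by
    have : s ω ∈ q ⁻¹' {ω} := by simp [hst]
    exact this
  have ht : ∀ ω, q (t ω) = ω := fun ω => by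
    have : t ω ∈ q ⁻¹' {ω} := by simp [hst]
    exact this
  have hw : ∀ w, w = s (q w) ∨ w = t (q w) := fun w => by
    have : w ∈ q ⁻¹' {q w} := rfl
    simpa [hst] using this
  refine ⟨fun w => if w = s (q w) then 0 else 1, ?_, ?_⟩
  · intro w₁ w₂ h
    obtain ⟨h₁, h₂⟩ := Prod.ext_iff.1 h
    simp only at h₁ h₂
    rcases hw w₁ with e₁ | e₁ <;> rcases hw w₂ with e₂ | e₂
    · rw [e₁, e₂, h₁]
    · rw [if_pos e₁, if_neg (e₂ ▸ by rw [ht]; exact (hne _).symm)] at h₂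
      exact absurd h₂ (by decide)
    · rw [if_pos e₂, if_neg (e₁ ▸ by rw [ht]; exact (hne _).symm)] at h₂
      exact absurd h₂ (by decide)
    · rw [e₁, e₂, h₁]
  · rintro ⟨ω, i⟩
    by_cases hi : i = 0
    · exact ⟨s ω, by simp [hs, hi]⟩
    · exact ⟨t ω, by simp [ht, (hne ω).symm, zmod_two_eq_one hi]⟩

/-- A permutation of a labelled cover lying over a permutation of the base has voltages. -/
theorem exists_voltage (hl : Function.Bijective fun w => (q w, l w)) {g : Equiv.Perm Ω'}
    {g₀ : Equiv.Perm Ω} (hg : ∀ w, q (g w) = g₀ (q w)) :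
    ∃ s : Ω → ZMod 2, ∀ w, l (g w) = l w + s (q w) := by
  choose t ht using fun ω => hl.2 (ω, 0)
  have ht₁ : ∀ ω, q (t ω) = ω := fun ω => congrArg Prod.fst (ht ω)
  have ht₂ : ∀ ω, l (t ω) = 0 := fun ω => congrArg Prod.snd (ht ω)
  -- The voltage is read off on sheet 0; injectivity of `g` forces the other point of the fibre onto
  -- the other label.
  refine ⟨fun ω => l (g (t ω)), fun w => ?_⟩
  by_cases h : l w = 0
  · have : w = t (q w) := hl.1 (Prod.ext (ht₁ _).symm (h.trans (ht₂ _).symm))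
    rw [h, zero_add]
    exact congrArg (fun v => l (g v)) this
  · have hne : l (g w) ≠ l (g (t (q w))) := fun h' => by
      have : g w = g (t (q w)) := hl.1 (Prod.ext (by simp only [hg, ht₁]) h')
      exact h ((congrArg l (g.injective this)).trans (ht₂ _))
    rw [zmod_two_eq_add_one hne, zmod_two_eq_one h, add_comm]

theorem pow_apply_of_semiconj {g : Equiv.Perm Ω'} {g₀ : Equiv.Perm Ω}
    (hg : ∀ w, q (g w) = g₀ (q w)) (n : ℕ) (w : Ω') : q ((g ^ n) w) = (g₀ ^ n) (q w) := by
  induction n with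
  | zero => rfl
  | succ n ih => rw [pow_succ', pow_succ', Equiv.Perm.mul_apply, Equiv.Perm.mul_apply, hg, ih]

theorem label_pow_apply {g : Equiv.Perm Ω'} {g₀ : Equiv.Perm Ω}
    (hg : ∀ w, q (g w) = g₀ (q w)) {s : Ω → ZMod 2} (hs : ∀ w, l (g w) = l w + s (q w))
    (n : ℕ) (w : Ω') :
    l ((g ^ n) w) = l w + ∑ j ∈ Finset.range n, s ((g₀ ^ j) (q w)) := by
  induction n with
  | zero => simp
  | succ n ih =>
    rw [pow_succ', Equiv.Perm.mul_apply, hs, ih, Finset.sum_range_succ, pow_apply_of_semiconj hg,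
      add_assoc]

theorem orderOf_eq_of_semiconj (hq : Function.Surjective q) {g : Equiv.Perm Ω'}
    {g₀ : Equiv.Perm Ω} (hg : ∀ w, q (g w) = g₀ (q w)) (h : g ^ orderOf g₀ = 1) :
    orderOf g = orderOf g₀ := by
  refine Nat.dvd_antisymm (orderOf_dvd_of_pow_eq_one h) (orderOf_dvd_of_pow_eq_one ?_)
  ext ω
  obtain ⟨w, rfl⟩ := hq ω
  rw [← pow_apply_of_semiconj hg, pow_orderOf_eq_one]
  rfl

/-- A lift of odd order has vanishing weighted cycle sums of voltages. -/
theorem sum_voltage_eq_zero_of_odd [Fintype Ω] (hq : Function.Surjective q) {g : Equiv.Perm Ω'}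
    {g₀ : Equiv.Perm Ω} (hg : ∀ w, q (g w) = g₀ (q w)) {s : Ω → ZMod 2}
    (hs : ∀ w, l (g w) = l w + s (q w)) {n : ℕ} (hn : Odd n) (hgn : g ^ n = 1)
    {α : Ω → ZMod 2} (hα : ∀ ω, α (g₀ ω) = α ω) : ∑ ω, α ω * s ω = 0 := by
  have h₀ : ∀ ω, ∑ j ∈ Finset.range n, s ((g₀ ^ j) ω) = 0 := fun ω => by
    obtain ⟨w, rfl⟩ := hq ω
    have := label_pow_apply hg hs n w
    rw [hgn] at this
    simpa using this
  have h₁ : ∀ j, ∑ ω, α ω * s ((g₀ ^ j) ω) = ∑ ω, α ω * s ω := fun j => by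
    rw [← Equiv.sum_comp (g₀ ^ j) (fun ω => α ω * s ω)]
    have : ∀ ω, α ((g₀ ^ j) ω) = α ω := fun ω => by
      induction j with
      | zero => rfl
      | succ j ih => rw [pow_succ', Equiv.Perm.mul_apply, hα, ih]
    simp only [this]
  -- The left side is `n` copies of the right side, and `n` is 1 modulo 2.
  have h₂ : ∑ ω, α ω * ∑ j ∈ Finset.range n, s ((g₀ ^ j) ω) = ∑ ω, α ω * s ω := by
    simp only [Finset.mul_sum]
    rw [Finset.sum_comm]
    simp only [h₁, Finset.sum_const, Finset.card_range, nsmul_eq_mul]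
    rw [(ZMod.natCast_eq_one_iff_odd).2 hn, one_mul]
  rw [← h₂]
  simp [h₀]

end Voltages

/-! ### The self-join as a Hurwitz double cover -/

section Join

variable {Ω : Type u} {D : Hypermap Ω} {k : ℕ} {a b : Ω}

open Classical in
/-- The voltages of `y` in a self-join. -/
noncomputable def joinVoltage (a b ω : Ω) : ZMod 2 := if ω = a ∨ ω = b then 1 else 0

/-- The sheets of a self-join. -/
def sheet : Ω ⊕ Ω → ZMod 2 := Sum.elim (fun _ => 0) (fun _ => 1)

theorem sheet_bijective :
    Function.Bijective fun w : Ω ⊕ Ω => (Sum.elim id id w, sheet w) := by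
  constructor
  · rintro (ω₁ | ω₁) (ω₂ | ω₂) h <;> simp_all [sheet]
  · rintro ⟨ω, i⟩
    by_cases hi : i = 0
    · exact ⟨Sum.inl ω, by simp [sheet, hi]⟩
    · exact ⟨Sum.inr ω, by simp [sheet, zmod_two_eq_one hi]⟩

open Classical in
theorem join_y_inl (h : D.IsHandle k a b) (ω : Ω) :
    (join h h).y (Sum.inl ω) = if ω = a ∨ ω = b then Sum.inr ω else Sum.inl (D.y ω) := by
  have hne := h.ne
  have ha := h.fixed_a
  have hb := h.fixed_b
  simp only [join, Equiv.Perm.mul_apply, Equiv.sumCongr_apply, Sum.map_inl]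
  by_cases h₁ : ω = a
  · subst h₁
    simp [ha, Equiv.swap_apply_def, hne]
  by_cases h₂ : ω = b
  · subst h₂
    simp [hb, Equiv.swap_apply_def, hne.symm]
  have h₁' : D.y ω ≠ a := fun e => h₁ (D.y.injective (e.trans ha.symm))
  have h₂' : D.y ω ≠ b := fun e => h₂ (D.y.injective (e.trans hb.symm))
  simp [h₁, h₂, h₁', h₂', Equiv.swap_apply_def]

open Classical in
theorem join_y_inr (h : D.IsHandle k a b) (ω : Ω) :
    (join h h).y (Sum.inr ω) = if ω = a ∨ ω = b then Sum.inl ω else Sum.inr (D.y ω) := by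
  have hne := h.ne
  have ha := h.fixed_a
  have hb := h.fixed_b
  simp only [join, Equiv.Perm.mul_apply, Equiv.sumCongr_apply, Sum.map_inr]
  by_cases h₁ : ω = a
  · subst h₁
    simp [ha, Equiv.swap_apply_def, hne]
  by_cases h₂ : ω = b
  · subst h₂
    simp [hb, Equiv.swap_apply_def, hne.symm]
  have h₁' : D.y ω ≠ a := fun e => h₁ (D.y.injective (e.trans ha.symm))
  have h₂' : D.y ω ≠ b := fun e => h₂ (D.y.injective (e.trans hb.symm))
  simp [h₁, h₂, h₁', h₂', Equiv.swap_apply_def]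

theorem join_map_x (h : D.IsHandle k a b) (w : Ω ⊕ Ω) :
    Sum.elim id id ((join h h).x w) = D.x (Sum.elim id id w) := by
  rcases w with ω | ω <;> rfl

theorem join_map_y (h : D.IsHandle k a b) (w : Ω ⊕ Ω) :
    Sum.elim id id ((join h h).y w) = D.y (Sum.elim id id w) := by
  have ha := h.fixed_a
  have hb := h.fixed_b
  rcases w with ω | ω <;> simp only [join_y_inl, join_y_inr] <;> split_ifs with h' <;>
    first | rfl | (rcases h' with rfl | rfl <;> simp [ha, hb])

theorem sheet_join_x (h : D.IsHandle k a b) (w : Ω ⊕ Ω) : sheet ((join h h).x w) = sheet w := by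
  rcases w with ω | ω <;> rfl

theorem sheet_join_y (h : D.IsHandle k a b) (w : Ω ⊕ Ω) :
    sheet ((join h h).y w) = sheet w + joinVoltage a b (Sum.elim id id w) := by
  rcases w with ω | ω <;> simp only [join_y_inl, join_y_inr, joinVoltage] <;> split_ifs with h' <;>
    simp_all [sheet, CharTwo.add_self_eq_zero]

theorem join_isCovering (h : D.IsHandle k a b) : IsCovering (join h h) D 2 (Sum.elim id id) where
  map_x := join_map_x h
  map_y := join_map_y h
  surjective ω := ⟨Sum.inl ω, rfl⟩
  card_fibre ω := by
    refine Set.ncard_eq_two.2 ⟨Sum.inl ω, Sum.inr ω, by simp, ?_⟩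
    ext (w | w) <;> simp

/-- The two ends of a handle lie on a common face. -/
theorem IsHandle.pow_apply_eq (h : D.IsHandle k a b) : ((D.y * D.x) ^ k) a = b := by
  -- As `z` is inverse to `y * x`, the handle equation involves its power `k - 1`; since `y` fixes
  -- `b`, the remaining `x` counts as one more face step.
  have h₁ : (D.y * D.x) ((D.z ^ (1 - (k : ℤ))) a) = b := by
    rw [Equiv.Perm.mul_apply, ← h.eq, h.fixed_b]
  rw [← h₁, ← Equiv.Perm.mul_apply, z, inv_zpow, ← zpow_neg, ← zpow_one_add]
  simp

/-- Along a face of a Hurwitz dessin, the voltages of a self-join add up to zero. -/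
theorem sum_joinVoltage_eq_zero (h : D.IsHandle k a b) (h7 : (D.y * D.x) ^ 7 = 1) (ω : Ω) :
    ∑ j ∈ Finset.range 7, joinVoltage a b (D.x (((D.y * D.x) ^ j) ω)) = 0 := by
  classical
  set w := D.y * D.x with hw
  -- Because `y` fixes `a` and `b`, the sum counts visits of the face walk to these two points.
  have hy : ∀ ω', joinVoltage a b (D.x ω') =
      (if w ω' = a then 1 else 0) + (if w ω' = b then 1 else 0) := fun ω' => by
    have e₁ : D.x ω' = a ↔ w ω' = a := by
      rw [hw, Equiv.Perm.mul_apply, ← D.y.injective.eq_iff, h.fixed_a]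
    have e₂ : D.x ω' = b ↔ w ω' = b := by
      rw [hw, Equiv.Perm.mul_apply, ← D.y.injective.eq_iff, h.fixed_b]
    have hne := h.ne
    simp only [joinVoltage, e₁, e₂]
    by_cases h₁ : w ω' = a <;> by_cases h₂ : w ω' = b <;> simp_all
  have hb : ∀ ω', w ((w ^ k) ω') = b ↔ w ω' = a := fun ω' => by
    rw [← h.pow_apply_eq, ← hw, ← Equiv.Perm.mul_apply, ← pow_succ', pow_succ,
      Equiv.Perm.mul_apply, (w ^ k).injective.eq_iff]
  have hmod : ∀ n, w ^ (n % 7) = w ^ n := fun n => by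
    conv_rhs => rw [← Nat.div_add_mod n 7, pow_add, pow_mul, h7, one_pow, one_mul]
  have key : ∑ j ∈ Finset.range 7, (if w ((w ^ j) ω) = b then (1 : ZMod 2) else 0) =
      ∑ j ∈ Finset.range 7, (if w ((w ^ j) ω) = a then 1 else 0) := by
    have h₁ := h.one_le
    have h₃ := h.le_three
    symm
    -- Each visit to `a` is followed `k` steps later by one to `b`, cyclically modulo 7.
    refine Finset.sum_nbij' (fun j => (j + k) % 7) (fun j => (j + (7 - k)) % 7) ?_ ?_ ?_ ?_ ?_
    · intro j _; simp; omega
    · intro j _; simp; omega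
    · intro j hj; simp at hj ⊢; omega
    · intro j hj; simp at hj ⊢; omega
    · intro j _
      have e : w ((w ^ ((j + k) % 7)) ω) = b ↔ w ((w ^ j) ω) = a := by
        rw [hmod, add_comm, pow_add]
        exact hb _
      simp only [e]
  simp only [hy, Finset.sum_add_distrib, key]
  exact CharTwo.add_self_eq_zero _

/-- Within a copy the new `y` differs from the old only at points the old one fixes, so an invariant
function is constant on each copy; the 2-cycle through `a` links the copies. -/
theorem join_transitive (h : D.IsHandle k a b) (hD : MulAction.IsPretransitive D.monodromy Ω) :
    MulAction.IsPretransitive (join h h).monodromy (Ω ⊕ Ω) := by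
  refine isPretransitive_of_invariant fun f hx hy => ?_
  have ha := h.fixed_a
  have hb := h.fixed_b
  have hl : ∀ ω₁ ω₂, f (Sum.inl ω₁) = f (Sum.inl ω₂) := by
    refine eq_of_invariant hD (f := fun ω => f (Sum.inl ω)) (fun ω => hx (Sum.inl ω)) fun ω => ?_
    by_cases hω : ω = a ∨ ω = b
    · rcases hω with rfl | rfl <;> simp only [ha, hb]
    · rw [← hy (Sum.inl ω), join_y_inl, if_neg hω]
  have hr : ∀ ω₁ ω₂, f (Sum.inr ω₁) = f (Sum.inr ω₂) := by
    refine eq_of_invariant hD (f := fun ω => f (Sum.inr ω)) (fun ω => hx (Sum.inr ω)) fun ω => ?_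
    by_cases hω : ω = a ∨ ω = b
    · rcases hω with rfl | rfl <;> simp only [ha, hb]
    · rw [← hy (Sum.inr ω), join_y_inr, if_neg hω]
  have hlr : f (Sum.inl a) = f (Sum.inr a) := by
    rw [← hy (Sum.inl a), join_y_inl, if_pos (Or.inl rfl)]
  have hall : ∀ w, f w = f (Sum.inl a) := by
    rintro (ω | ω)
    · exact hl _ _
    · exact (hr _ _).trans hlr.symm
  exact fun w₁ w₂ => (hall w₁).trans (hall w₂).symm

theorem IsHurwitz.orderOf_y_mul_x (hD : D.IsHurwitz) : orderOf (D.y * D.x) = 7 := by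
  rw [← orderOf_inv]
  exact hD.order_z

theorem IsHurwitz.nonempty (hD : D.IsHurwitz) : Nonempty Ω := by
  by_contra hne
  rw [not_nonempty_iff] at hne
  have := hD.order_x
  rw [Subsingleton.elim D.x 1, orderOf_one] at this
  omega

theorem map_y_mul_x {Ω' : Type v} {E : Hypermap Ω'} {q : Ω' → Ω}
    (hx : ∀ w, q (E.x w) = D.x (q w)) (hy : ∀ w, q (E.y w) = D.y (q w)) (w : Ω') :
    q ((E.y * E.x) w) = (D.y * D.x) (q w) := by
  rw [Equiv.Perm.mul_apply, hy, hx]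
  rfl

/-- A transitive cover satisfying the relations of the triangle group is a Hurwitz dessin. -/
theorem IsHurwitz.of_semiconj {Ω' : Type v} [Finite Ω'] {E : Hypermap Ω'} {q : Ω' → Ω}
    (hD : D.IsHurwitz) (hq : Function.Surjective q)
    (hx : ∀ w, q (E.x w) = D.x (q w)) (hy : ∀ w, q (E.y w) = D.y (q w))
    (h3 : E.x ^ 3 = 1) (h2 : E.y ^ 2 = 1) (h7 : (E.y * E.x) ^ 7 = 1)
    (ht : MulAction.IsPretransitive E.monodromy Ω') : E.IsHurwitz where
  finite := ‹_›
  order_x := by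
    rw [← hD.order_x]
    exact orderOf_eq_of_semiconj hq hx (by rwa [hD.order_x])
  order_y := by
    rw [← hD.order_y]
    exact orderOf_eq_of_semiconj hq hy (by rwa [hD.order_y])
  order_z := by
    rw [z, orderOf_inv, ← hD.orderOf_y_mul_x]
    exact orderOf_eq_of_semiconj hq (map_y_mul_x hx hy) (by rwa [hD.orderOf_y_mul_x])
  transitive := ht

/-- Each relation is checked in coordinates: it holds on the base, and the sheet changes by a
voltage sum that vanishes. -/
theorem join_isHurwitz (hD : D.IsHurwitz) (h : D.IsHandle k a b) : (join h h).IsHurwitz := by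
  have := hD.finite
  have hinj := (sheet_bijective (Ω := Ω)).1
  have h7 : (D.y * D.x) ^ 7 = 1 := hD.orderOf_y_mul_x ▸ pow_orderOf_eq_one _
  have h3 : D.x ^ 3 = 1 := hD.order_x ▸ pow_orderOf_eq_one _
  have h2 : D.y ^ 2 = 1 := hD.order_y ▸ pow_orderOf_eq_one _
  refine hD.of_semiconj (join_isCovering h).surjective (join_map_x h) (join_map_y h)
    ?_ ?_ ?_ (join_transitive h hD.transitive)
  · refine Equiv.ext fun w => hinj (Prod.ext ?_ ?_)
    · simp only [pow_apply_of_semiconj (join_map_x h), h3]; rfl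
    · simp only
      rw [label_pow_apply (l := sheet) (s := 0) (join_map_x h) (by simp [sheet_join_x])]
      simp
  · refine Equiv.ext fun w => hinj (Prod.ext ?_ ?_)
    · simp only [pow_apply_of_semiconj (join_map_y h), h2]; rfl
    · simp only
      rw [label_pow_apply (join_map_y h) (sheet_join_y h)]
      have e : joinVoltage a b (D.y (Sum.elim id id w)) = joinVoltage a b (Sum.elim id id w) := by
        have ha : ∀ ω, D.y ω = a ↔ ω = a := fun ω => by
          conv_lhs => rw [← h.fixed_a, D.y.injective.eq_iff]
        have hb : ∀ ω, D.y ω = b ↔ ω = b := fun ω => by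
          conv_lhs => rw [← h.fixed_b, D.y.injective.eq_iff]
        unfold joinVoltage
        rw [ha, hb]
      simp [Finset.sum_range_succ, e, CharTwo.add_self_eq_zero]
  · refine Equiv.ext fun w => hinj (Prod.ext ?_ ?_)
    · simp only [pow_apply_of_semiconj (map_y_mul_x (join_map_x h) (join_map_y h)), h7]; rfl
    · simp only
      rw [label_pow_apply (l := sheet) (s := fun ω => joinVoltage a b (D.x ω))
        (map_y_mul_x (join_map_x h) (join_map_y h))]
      · rw [sum_joinVoltage_eq_zero h h7]
        simp
      · intro w
        rw [Equiv.Perm.mul_apply, sheet_join_y, sheet_join_x, join_map_x]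

end Join

/-! ### Uniqueness of the double cover -/

section Uniqueness

variable {Ω : Type u} {Ω' : Type v} {D : Hypermap Ω} {E : Hypermap Ω'} {q : Ω' → Ω}
  {k : ℕ} {a b : Ω}

/-- Every connected double cover of a planar Hurwitz dessin whose involution has exactly two fixed
points, forming a handle, is isomorphic to the self-join. -/
theorem exists_iso_join (hD : D.IsHurwitz) (hplanar : D.IsPlanar) (h : D.IsHandle k a b)
    (hfix : {ω : Ω | D.y ω = ω} = {a, b}) (hE : E.IsHurwitz) (hq : IsCovering E D 2 q) :
    ∃ e : Ω ⊕ Ω ≃ Ω', IsIso (join h h) E e ∧ ∀ ω, q (e ω) = Sum.elim id id ω := by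
  classical
  have := hD.finite
  have := hD.nonempty
  have := Fintype.ofFinite Ω
  have hqs := hq.surjective
  obtain ⟨l, hl⟩ := exists_labelling hq.card_fibre
  obtain ⟨sx, hsx⟩ := exists_voltage hl hq.map_x
  obtain ⟨sy, hsy⟩ := exists_voltage hl hq.map_y
  have hsw : ∀ w, l ((E.y * E.x) w) = l w + (sx (q w) + sy (D.x (q w))) := fun w => by
    rw [Equiv.Perm.mul_apply, hsy, hsx, hq.map_x, add_assoc]
  have hjq := (join_isCovering h).surjective
  have hjw : ∀ w, sheet (((join h h).y * (join h h).x) w) =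
      sheet w + joinVoltage a b (D.x (Sum.elim id id w)) := fun w => by
    rw [Equiv.Perm.mul_apply, sheet_join_y, sheet_join_x, join_map_x]
  have hfix' : ∀ ω, D.y ω = ω → ω = a ∨ ω = b := fun ω hω => by
    have : ω ∈ {ω : Ω | D.y ω = ω} := hω
    simpa [hfix] using this
  have hE3 : E.x ^ 3 = 1 := hE.order_x ▸ pow_orderOf_eq_one _
  have hE2 : E.y ^ 2 = 1 := hE.order_y ▸ pow_orderOf_eq_one _
  have hE7 : (E.y * E.x) ^ 7 = 1 := hE.orderOf_y_mul_x ▸ pow_orderOf_eq_one _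
  have hJ := join_isHurwitz hD h
  have hJ7 : ((join h h).y * (join h h).x) ^ 7 = 1 :=
    hJ.orderOf_y_mul_x ▸ pow_orderOf_eq_one _
  have hJ2 : (join h h).y ^ 2 = 1 := hJ.order_y ▸ pow_orderOf_eq_one _
  have odd3 : Odd 3 := by decide
  have odd7 : Odd 7 := by decide
  have sumx : ∀ α : Ω → ZMod 2, (∀ ω, α (D.x ω) = α ω) → ∑ ω, α ω * sx ω = 0 :=
    fun α hα => sum_voltage_eq_zero_of_odd hqs hq.map_x hsx odd3 hE3 hα
  have sumz : ∀ α : Ω → ZMod 2, (∀ ω, α (D.y (D.x ω)) = α ω) →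
      ∑ ω, α ω * (sx ω + sy (D.x ω)) = 0 :=
    fun α hα => sum_voltage_eq_zero_of_odd hqs (map_y_mul_x hq.map_x hq.map_y) hsw odd7 hE7 hα
  have sumzj : ∀ α : Ω → ZMod 2, (∀ ω, α (D.y (D.x ω)) = α ω) →
      ∑ ω, α ω * joinVoltage a b (D.x ω) = 0 :=
    fun α hα => sum_voltage_eq_zero_of_odd hjq (map_y_mul_x (join_map_x h) (join_map_y h)) hjw
      odd7 hJ7 hα
  -- Compare the sum over all faces with the sum over all black vertices.
  have total : ∑ ω, sy ω = 0 := by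
    have h₁ := sumx (fun _ => 1) fun _ => rfl
    have h₂ := sumz (fun _ => 1) fun _ => rfl
    have h₃ : ∑ ω, sy (D.x ω) = ∑ ω, sy ω := Equiv.sum_comp D.x sy
    simp only [one_mul] at h₁ h₂
    rwa [Finset.sum_add_distrib, h₁, zero_add, h₃] at h₂
  have inv2 : ∀ ω, D.y (D.y ω) = ω := fun ω => by
    obtain ⟨w, rfl⟩ := hqs ω
    rw [← hq.map_y, ← hq.map_y, ← Equiv.Perm.mul_apply, ← sq, hE2]
    rfl
  have pair : ∀ ω, sy ω + sy (D.y ω) = 0 := fun ω => by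
    obtain ⟨w, rfl⟩ := hqs ω
    have := label_pow_apply hq.map_y hsy 2 w
    rw [hE2] at this
    simpa [Finset.sum_range_succ] using this
  -- Away from `a` and `b` the involution `y` pairs points with cancelling voltages.
  have hsab : sy a + sy b = 0 := by
    have hne := h.ne
    have h₁ : ∑ ω, (if ω = a ∨ ω = b then 0 else sy ω) = 0 := by
      refine Finset.sum_ninvolution D.y (fun ω => ?_) (fun ω h₀ h₁ => h₀ (if_pos (hfix' ω h₁)))
        (fun _ => Finset.mem_univ _) inv2
      have ha : D.y ω = a ↔ ω = a := by conv_lhs => rw [← h.fixed_a, D.y.injective.eq_iff]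
      have hb : D.y ω = b ↔ ω = b := by conv_lhs => rw [← h.fixed_b, D.y.injective.eq_iff]
      rw [ha, hb]
      split_ifs
      · rfl
      · exact pair ω
    have h₂ : ∀ ω, sy ω = (if ω = a ∨ ω = b then 0 else sy ω) +
        ((if ω = a then sy a else 0) + (if ω = b then sy b else 0)) := fun ω => by
      by_cases e₁ : ω = a
      · subst e₁; simp [hne]
      by_cases e₂ : ω = b
      · subst e₂; simp [hne.symm]
      simp [e₁, e₂]
    rw [Finset.sum_congr rfl fun ω _ => h₂ ω, Finset.sum_add_distrib, h₁,
      Finset.sum_add_distrib] at total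
    simpa using total
  -- The correction cancels the voltages at both fixed points and keeps face sums zero, since the
  -- self-join has zero face sums too.
  obtain ⟨f, hf⟩ := exists_coboundary_eq D hD.transitive hplanar
    (sx, fun ω => sy ω + sy a * joinVoltage a b ω) sumx
    (fun α hα => by
      refine Finset.sum_ninvolution D.y (fun ω => ?_) (fun ω h₀ h₁ => h₀ ?_)
        (fun _ => Finset.mem_univ _) inv2
      · have ha : D.y ω = a ↔ ω = a := by conv_lhs => rw [← h.fixed_a, D.y.injective.eq_iff]
        have hb : D.y ω = b ↔ ω = b := by conv_lhs => rw [← h.fixed_b, D.y.injective.eq_iff]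
        have hj : joinVoltage a b (D.y ω) = joinVoltage a b ω := by
          unfold joinVoltage
          rw [ha, hb]
        have h₂ := CharTwo.add_self_eq_zero (sy a * joinVoltage a b ω)
        simp only [hα, hj]
        linear_combination α ω * pair ω + α ω * h₂
      · rcases hfix' ω h₁ with rfl | rfl
        · simp [joinVoltage, CharTwo.add_self_eq_zero]
        · simp [joinVoltage, add_comm (sy ω), hsab])
    (fun α hα => by
      have h₁ := sumz α hα
      have h₂ := sumzj α hα
      have h₃ : ∀ ω, α ω * (sx ω + (sy (D.x ω) + sy a * joinVoltage a b (D.x ω))) =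
          α ω * (sx ω + sy (D.x ω)) + sy a * (α ω * joinVoltage a b (D.x ω)) :=
        fun ω => by ring
      simp only [h₃, Finset.sum_add_distrib, ← Finset.mul_sum, h₁, h₂]
      simp)
  have hfx : ∀ ω, f (D.x ω) + f ω = sx ω := congrFun (congrArg Prod.fst hf)
  have hfy : ∀ ω, f (D.y ω) + f ω = sy ω + sy a * joinVoltage a b ω :=
    congrFun (congrArg Prod.snd hf)
  by_cases hsa : sy a = 0
  · exfalso
    -- The relabelling by `f` makes all voltages zero, so the sheet would be constant on a connected
    -- cover.
    have hconst := eq_of_invariant hE.transitive (f := fun w => l w + f (q w))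
      (fun w => by
        have h₁ := hfx (q w)
        have h₂ := CharTwo.add_self_eq_zero (f (D.x (q w)))
        simp only [hsx, hq.map_x]
        linear_combination h₂ - h₁)
      (fun w => by
        have h₁ := hfy (q w)
        have h₂ := CharTwo.add_self_eq_zero (f (D.y (q w)))
        simp only [hsy, hq.map_y]
        rw [hsa] at h₁
        linear_combination h₂ - h₁)
    obtain ⟨w₀, hw₀⟩ := hl.2 (a, 0)
    obtain ⟨w₁, hw₁⟩ := hl.2 (a, 1)
    obtain ⟨h₁, h₂⟩ := Prod.ext_iff.1 hw₀
    obtain ⟨h₃, h₄⟩ := Prod.ext_iff.1 hw₁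
    have h₅ := hconst w₀ w₁
    simp only at h₁ h₂ h₃ h₄ h₅
    rw [h₁, h₂, h₃, h₄, add_left_inj] at h₅
    exact absurd h₅ (by decide)
  · have hsa := zmod_two_eq_one hsa
    -- In these new labels `x` preserves sheets and `y` has voltage `joinVoltage a b`, exactly as in
    -- the self-join.
    have hbij : Function.Bijective fun w : Ω' => (q w, l w + f (q w)) := by
      constructor
      · intro w₁ w₂ hw
        obtain ⟨h₁, h₂⟩ := Prod.ext_iff.1 hw
        simp only at h₁ h₂
        rw [h₁, add_left_inj] at h₂
        exact hl.1 (Prod.ext h₁ h₂)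
      · rintro ⟨ω, i⟩
        obtain ⟨w, hw⟩ := hl.2 (ω, i - f ω)
        obtain ⟨h₁, h₂⟩ := Prod.ext_iff.1 hw
        simp only at h₁ h₂
        exact ⟨w, by simp [h₁, h₂]⟩
    let e : Ω ⊕ Ω ≃ Ω' :=
      (Equiv.ofBijective _ sheet_bijective).trans (Equiv.ofBijective _ hbij).symm
    have he : ∀ v, (q (e v), l (e v) + f (q (e v))) = (Sum.elim id id v, sheet v) := fun v =>
      (Equiv.ofBijective _ hbij).apply_symm_apply _
    have he₁ : ∀ v, q (e v) = Sum.elim id id v := fun v => (Prod.ext_iff.1 (he v)).1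
    have he₂ : ∀ v, l (e v) + f (Sum.elim id id v) = sheet v := fun v => by
      rw [← he₁]
      exact (Prod.ext_iff.1 (he v)).2
    refine ⟨e, ⟨fun v => hbij.1 (Prod.ext ?_ ?_), fun v => hbij.1 (Prod.ext ?_ ?_)⟩, he₁⟩
    · simp only [he₁, hq.map_x, join_map_x]
    · have h₁ := hfx (Sum.elim id id v)
      have h₂ := CharTwo.add_self_eq_zero (f (D.x (Sum.elim id id v)))
      simp only [he₁, hq.map_x, hsx]
      rw [he₂, sheet_join_x, ← he₂]
      linear_combination h₁ - h₂
    · simp only [he₁, hq.map_y, join_map_y]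
    · have h₁ := hfy (Sum.elim id id v)
      have h₂ := CharTwo.add_self_eq_zero (f (D.y (Sum.elim id id v)))
      have h₃ := CharTwo.add_self_eq_zero (joinVoltage a b (Sum.elim id id v))
      simp only [he₁, hq.map_y, hsy]
      rw [he₂, sheet_join_y, ← he₂]
      rw [hsa] at h₁
      linear_combination h₁ - h₂ + h₃

end Uniqueness

/-! ### Coset covers and their monodromy groups -/

section Monodromy

variable {Ω : Type u} {D : Hypermap Ω}

theorem closure_genX_genY (D : Hypermap Ω) :
    Subgroup.closure {D.genX, D.genY} = (⊤ : Subgroup D.monodromy) := by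
  have h := Subgroup.closure_closure_coe_preimage (k := ({D.x, D.y} : Set (Equiv.Perm Ω)))
  refine Eq.trans ?_ h
  congr 1
  ext g
  simp only [Set.mem_insert_iff, Set.mem_singleton_iff, Subtype.ext_iff, genX, genY]
  rfl

/-- The hypermap of cosets of a subgroup of the monodromy group. -/
def cosetHypermap (D : Hypermap Ω) (K : Subgroup D.monodromy) : Hypermap (D.monodromy ⧸ K) where
  x := MulAction.toPerm D.genX
  y := MulAction.toPerm D.genY

theorem cosetHypermap_transitive (D : Hypermap Ω) (K : Subgroup D.monodromy) :
    MulAction.IsPretransitive (D.cosetHypermap K).monodromy (D.monodromy ⧸ K) := by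
  refine isPretransitive_of_invariant fun f hx hy => ?_
  have key : ∀ (g : D.monodromy) (c : D.monodromy ⧸ K), f (g • c) = f c := fun g => by
    have hg : g ∈ Subgroup.closure {D.genX, D.genY} := by
      rw [closure_genX_genY]
      trivial
    induction hg using Subgroup.closure_induction with
    | mem g hg =>
      rcases hg with rfl | rfl
      · exact hx
      · exact hy
    | one => simp
    | mul g h _ _ hg hh => intro c; rw [mul_smul, hg, hh]
    | inv g _ hg => intro c; rw [← hg, smul_inv_smul]
  intro c₁ c₂
  obtain ⟨g, rfl⟩ := MulAction.exists_smul_eq D.monodromy c₁ c₂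
  exact (key g c₁).symm

/-- The projection from the cosets of a subgroup of a point stabiliser. -/
def cosetProj {ω : Ω} {K : Subgroup D.monodromy} (hK : K ≤ MulAction.stabilizer D.monodromy ω) :
    D.monodromy ⧸ K → Ω :=
  fun c => MulAction.ofQuotientStabilizer D.monodromy ω (Subgroup.quotientMapOfLE hK c)

theorem cosetProj_mk {ω : Ω} {K : Subgroup D.monodromy}
    (hK : K ≤ MulAction.stabilizer D.monodromy ω) (g : D.monodromy) :
    cosetProj hK (g : D.monodromy ⧸ K) = g • ω := rfl

theorem cosetProj_smul {ω : Ω} {K : Subgroup D.monodromy}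
    (hK : K ≤ MulAction.stabilizer D.monodromy ω) (g : D.monodromy) (c : D.monodromy ⧸ K) :
    cosetProj hK (g • c) = g • cosetProj hK c := by
  induction c using QuotientGroup.induction_on with
  | H h => exact mul_smul g h ω

theorem coset_isCovering (hD : D.IsHurwitz) {ω : Ω} {K : Subgroup D.monodromy}
    (hK : K ≤ MulAction.stabilizer D.monodromy ω)
    (h2 : K.relIndex (MulAction.stabilizer D.monodromy ω) = 2) :
    IsCovering (D.cosetHypermap K) D 2 (cosetProj hK) where
  map_x := cosetProj_smul hK D.genX
  map_y := cosetProj_smul hK D.genY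
  surjective ω' := by
    obtain ⟨g, rfl⟩ := hD.transitive.exists_smul_eq ω ω'
    exact ⟨g, rfl⟩
  card_fibre ω' := by
    obtain ⟨g, rfl⟩ := hD.transitive.exists_smul_eq ω ω'
    obtain ⟨t, ht, hxor⟩ := Subgroup.relIndex_eq_two_iff.1 h2
    have ht' : t ∉ K := fun h => by
      have := hxor 1 (one_mem _)
      simp [h, one_mem, Xor] at this
    refine Set.ncard_eq_two.2 ⟨(g : D.monodromy ⧸ K), ((g * t⁻¹ : D.monodromy) : _ ⧸ K), ?_, ?_⟩
    · rw [Ne, QuotientGroup.eq]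
      simpa using ht'
    · ext c
      induction c using QuotientGroup.induction_on with
      | H c =>
        simp only [Set.mem_preimage, Set.mem_singleton_iff, Set.mem_insert_iff, cosetProj_mk]
        constructor
        · intro hc
          have hs : c⁻¹ * g ∈ MulAction.stabilizer D.monodromy ω := by
            rw [MulAction.mem_stabilizer_iff, mul_smul, ← hc, inv_smul_smul]
          -- Index 2 is used at `c⁻¹ * g * t⁻¹`: either it or `c⁻¹ * g` lies in `K`, which decides
          -- the coset of `c`.
          rw [QuotientGroup.eq, QuotientGroup.eq]
          have hi : (c⁻¹ * g) * t⁻¹ * t = c⁻¹ * g := by group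
          have := hxor _ (mul_mem hs (inv_mem ht))
          rw [hi] at this
          rw [← mul_assoc]
          exact this.imp And.left And.left
        · have ht₂ : t⁻¹ • ω = ω := MulAction.mem_stabilizer_iff.1 (inv_mem ht)
          rintro (hc | hc)
          · exact congrArg (cosetProj hK) hc
          · refine (congrArg (cosetProj hK) hc).trans ?_
            rw [cosetProj_mk, mul_smul, ht₂]

/-- The triangle group relations hold in the monodromy group, hence in each of its actions. -/
theorem coset_isHurwitz (hD : D.IsHurwitz) {ω : Ω} {K : Subgroup D.monodromy}
    (hK : K ≤ MulAction.stabilizer D.monodromy ω)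
    (h2 : K.relIndex (MulAction.stabilizer D.monodromy ω) = 2) :
    (D.cosetHypermap K).IsHurwitz := by
  have := hD.finite
  have hc := coset_isCovering hD hK h2
  have hpow : ∀ (g : D.monodromy) (n : ℕ), (g : Equiv.Perm Ω) ^ n = 1 →
      (MulAction.toPermHom D.monodromy (D.monodromy ⧸ K) g) ^ n = 1 := fun g n hg => by
    rw [← map_pow, show g ^ n = 1 from Subtype.ext hg, map_one]
  refine hD.of_semiconj hc.surjective hc.map_x hc.map_y
    (hpow D.genX 3 (hD.order_x ▸ pow_orderOf_eq_one D.x))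
    (hpow D.genY 2 (hD.order_y ▸ pow_orderOf_eq_one D.y)) ?_ (cosetHypermap_transitive D K)
  have := hpow (D.genY * D.genX) 7 (hD.orderOf_y_mul_x ▸ pow_orderOf_eq_one (D.y * D.x))
  rwa [map_mul] at this

/-- The stabiliser of the coset of `h` is the conjugate of `K` by `h`, which is `K` because index 2
makes `K` normal in `H`. Hence both points above `ω` have the same stabiliser. -/
theorem smul_coset_eq_iff {G : Type*} [Group G] {K H : Subgroup G} (hK : K ≤ H)
    (h2 : K.relIndex H = 2) {h : G} (hh : h ∈ H) (g : G) :
    g • (h : G ⧸ K) = h ↔ g ∈ K := by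
  have hn : (K.subgroupOf H).Normal := Subgroup.normal_of_index_eq_two h2
  have hconj : ∀ n ∈ K, ∀ h ∈ H, h * n * h⁻¹ ∈ K := fun n hn' h hh =>
    hn.conj_mem ⟨n, hK hn'⟩ hn' ⟨h, hh⟩
  rw [MulAction.Quotient.smul_coe, smul_eq_mul, eq_comm, QuotientGroup.eq]
  constructor
  · intro hg
    simpa [mul_assoc] using hconj _ hg h hh
  · intro hg
    simpa [mul_assoc] using hconj g hg h⁻¹ (inv_mem hh)

/-- A hypermap isomorphic to a double cover by cosets of the monodromy group has the same
monodromy group. -/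
theorem exists_monodromy_mulEquiv (hD : D.IsHurwitz) {ω : Ω} {K : Subgroup D.monodromy}
    (hK : K ≤ MulAction.stabilizer D.monodromy ω)
    (h2 : K.relIndex (MulAction.stabilizer D.monodromy ω) = 2)
    {Ω' : Type v} {J : Hypermap Ω'} {e : Ω' ≃ D.monodromy ⧸ K}
    (he : IsIso J (D.cosetHypermap K) e) :
    ∃ φ : J.monodromy ≃* D.monodromy, φ J.genX = D.genX ∧ φ J.genY = D.genY ∧
      ∀ w, cosetProj hK (e w) = ω →
        (MulAction.stabilizer J.monodromy w).map φ.toMonoidHom = K := by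
  let θ : D.monodromy →* Equiv.Perm Ω' :=
    e.symm.permCongrHom.toMonoidHom.comp (MulAction.toPermHom D.monodromy (D.monodromy ⧸ K))
  have hθ : ∀ g w, e (θ g w) = g • e w := fun g w => e.apply_symm_apply _
  have hθx : θ D.genX = J.x := Equiv.ext fun w => e.injective ((hθ _ _).trans (he.map_x w).symm)
  have hθy : θ D.genY = J.y := Equiv.ext fun w => e.injective ((hθ _ _).trans (he.map_y w).symm)
  -- An element acting trivially on the cosets acts trivially on their image `Ω`, where the
  -- monodromy group is faithful.
  have hinj : Function.Injective θ := by
    rw [injective_iff_map_eq_one]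
    intro g hg
    refine Subtype.ext (Equiv.ext fun ω' => ?_)
    obtain ⟨c, rfl⟩ := (coset_isCovering hD hK h2).surjective ω'
    have := hθ g (e.symm c)
    rw [hg, Equiv.Perm.one_apply, e.apply_symm_apply] at this
    change g • cosetProj hK c = cosetProj hK c
    rw [← cosetProj_smul, ← this]
  have hrange : θ.range = J.monodromy := by
    rw [MonoidHom.range_eq_map, ← closure_genX_genY, MonoidHom.map_closure, Set.image_pair, hθx,
      hθy]
    rfl
  let ψ : D.monodromy ≃* J.monodromy :=
    (MonoidHom.ofInjective hinj).trans (MulEquiv.subgroupCongr hrange)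
  have hψ : ∀ g w, ψ g • w = θ g w := fun _ _ => rfl
  refine ⟨ψ.symm, ?_, ?_, fun w hw => ?_⟩
  · rw [MulEquiv.symm_apply_eq]
    exact Subtype.ext hθx.symm
  · rw [MulEquiv.symm_apply_eq]
    exact Subtype.ext hθy.symm
  · ext g
    obtain ⟨h, hh⟩ := QuotientGroup.mk_surjective (e w)
    rw [← hh, cosetProj_mk] at hw
    rw [← smul_coset_eq_iff hK h2 (MulAction.mem_stabilizer_iff.2 hw) g]
    have hg : g ∈ (MulAction.stabilizer J.monodromy w).map ψ.symm.toMonoidHom ↔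
        ψ g ∈ MulAction.stabilizer J.monodromy w := by
      constructor
      · rintro ⟨g', hg', rfl⟩
        simpa using hg'
      · exact fun hg => ⟨ψ g, hg, ψ.symm_apply_apply g⟩
    rw [hg, MulAction.mem_stabilizer_iff, hψ, ← e.injective.eq_iff, hθ]
    change _ ↔ g • (QuotientGroup.mk h : D.monodromy ⧸ K) = QuotientGroup.mk h
    rw [hh]

end Monodromy

end Hypermap

theorem lemma4p4 {Ω : Type u} (D : Hypermap Ω) (hD : D.IsHurwitz) (hplanar : D.IsPlanar)
    (k : ℕ) (a b : Ω) (hab : D.IsHandle k a b) (hfix : {ω : Ω | D.y ω = ω} = {a, b}) :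
    -- the self-join is a Hurwitz dessin and, by its natural projection, a double cover of `D`
    (Hypermap.join hab hab).IsHurwitz ∧
    Hypermap.IsCovering (Hypermap.join hab hab) D 2 (Sum.elim id id) ∧
    -- every Hurwitz dessin doubly covering `D` is isomorphic to it, as a covering of `D`
    (∀ (Ω' : Type v) (E : Hypermap Ω') (q : Ω' → Ω), E.IsHurwitz → Hypermap.IsCovering E D 2 q →
      ∃ e : Ω ⊕ Ω ≃ Ω', Hypermap.IsIso (Hypermap.join hab hab) E e ∧
        ∀ ω, q (e ω) = Sum.elim id id ω) ∧
    -- monodromy group and point stabilisers, if a stabiliser has a subgroup of index 2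
    (∀ (ω : Ω) (Hs : Subgroup D.monodromy),
      Hs ≤ MulAction.stabilizer D.monodromy ω →
      Hs.relIndex (MulAction.stabilizer D.monodromy ω) = 2 →
      ∃ φ : (Hypermap.join hab hab).monodromy ≃* D.monodromy,
        φ (Hypermap.join hab hab).genX = D.genX ∧
        φ (Hypermap.join hab hab).genY = D.genY ∧
        ∀ ω' : Ω ⊕ Ω, Sum.elim id id ω' = ω →
          (MulAction.stabilizer (Hypermap.join hab hab).monodromy ω').map φ.toMonoidHom = Hs) := by
  refine ⟨Hypermap.join_isHurwitz hD hab, Hypermap.join_isCovering hab,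
    fun Ω' E q hE hq => Hypermap.exists_iso_join hD hplanar hab hfix hE hq, fun ω Hs hle h2 => ?_⟩
  obtain ⟨e, he, hproj⟩ := Hypermap.exists_iso_join hD hplanar hab hfix
    (Hypermap.coset_isHurwitz hD hle h2) (Hypermap.coset_isCovering hD hle h2)
  obtain ⟨φ, hx, hy, hφ⟩ := Hypermap.exists_monodromy_mulEquiv hD hle h2 he
  exact ⟨φ, hx, hy, fun ω' hω' => hφ ω' ((hproj ω').trans hω')⟩
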